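/- Let $n\ge 1$ and identify $\mathbb{C}^n$ with $\mathbb{R}^{2n}$, with real coordinates $x_1,\dots,x_{2n}$ (the real and imaginary parts of the complex coordinates). Let $\Omega\subset\mathbb{C}^n$ be a domain (a nonempty connected open set), and let $E\subset\Omega$ be closed in $\Omega$ with $\mathcal{H}^{2n-1}(E)=0$, where $\mathcal{H}^{2n-1}$ is the $(2n-1)$-dimensional Hausdorff measure. Let $f:\Omega\setminus E\to\mathbb{C}$ be holomorphic. If for each $j$, $1\le j\le 2n$, $\frac{\partial f}{\partial x_j}\in\mathcal{L}^2_{\mathrm{loc}}(\Omega)$, that is, $\left|\frac{\partial f}{\partial x_j}\right|^2$, which is defined outside the Lebesgue null set $E$, is locally integrable on $\Omega$ with respect to Lebesgue measure, then $f$ has a holomorphic extension to $\Omega$, that is, there is a holomorphic function $f^*:\Omega\to\mathbb{C}$ with $f^*=f$ on $\Omega\setminus E$. -/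

import Mathlib

open MeasureTheory Set

/-- The space `L^p_loc(Ω)`, `p > 0`: measurable functions `u` on `Ω ⊆ ℂⁿ = ℝ²ⁿ` for which `|u|^p` is
locally integrable on `Ω` with respect to Lebesgue measure. -/
structure MemLpLocOn {n : ℕ} (p : ℝ) (u : EuclideanSpace ℂ (Fin n) → ℂ)
    (Ω : Set (EuclideanSpace ℂ (Fin n))) : Prop where
  aestronglyMeasurable : AEStronglyMeasurable u (volume.restrict Ω)
  locallyIntegrableOn : LocallyIntegrableOn (fun z => ‖u z‖ ^ p) Ω volume

/-- The `2n` coordinate vectors of `ℝ²ⁿ = ℂⁿ`, indexed by `Fin n × Fin 2`: the index `(k, 0)` gives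
the vector `e_k` (direction of `Re z_k`), and `(k, 1)` gives `i e_k` (direction of `Im z_k`). -/
noncomputable def realCoordVec {n : ℕ} (j : Fin n × Fin 2) : EuclideanSpace ℂ (Fin n) :=
  EuclideanSpace.single j.1 (![1, Complex.I] j.2)

/-- The first partial derivative `∂f/∂x_j (z)` of `f` with respect to the real coordinate `x_j` of
`ℝ²ⁿ = ℂⁿ`. -/
noncomputable def realPartialDeriv {n : ℕ} (j : Fin n × Fin 2)
    (f : EuclideanSpace ℂ (Fin n) → ℂ) (z : EuclideanSpace ℂ (Fin n)) : ℂ :=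
  lineDeriv ℝ f z (realCoordVec j)

open Filter Function Metric Topology Module
open scoped ENNReal NNReal

/-!
Write `d` for the real dimension. If `E` is `μH[d - 1]`-null then `E × ℝ` is `μH[d]`-null, so along
a `C¹` family of balls `w ↦ p s + c s • w`, `‖w‖ ≤ 1`, the path of almost every `w` misses `E`: the
exceptional `w` lie in the image of `E × ℝ` under the locally Lipschitz map
`(x, s) ↦ (c s)⁻¹ • (x - p s)`. Averaging the fundamental theorem of calculus over `w` expresses the
change of the ball mean of `f` through the integrable function `fderiv ℂ f`.

Rotating a ball about its centre `z` by `exp (i s)` does not change the ball, so the mean of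
`fderiv ℂ f x (x - z)` over it, multiplied by `i`, has vanishing integral over a period, hence
vanishes. Along concentric balls of growing radius this mean is, up to a factor, the derivative of
the ball mean of `f`, which is thus constant: this is the mean value property at points off `E`.
Along translated balls the ball mean of `f` has the mean of `fderiv ℂ f` as its derivative, so it is
holomorphic, and by the mean value property it extends `f` across `E`.
-/

section HausdorffProduct

variable {X : Type*} [EMetricSpace X] {d : ℝ}

theorem Icc_subset_iUnion_Icc_mul (a : ℝ) {ρ : ℝ} (hρ : 0 < ρ) :
    Icc a (a + 1) ⊆
      ⋃ k ∈ Finset.range (⌊ρ⁻¹⌋₊ + 1), Icc (a + k * ρ) (a + k * ρ + ρ) := by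
  intro t ht
  have ht' : 0 ≤ (t - a) / ρ := div_nonneg (sub_nonneg.2 ht.1) hρ.le
  have hlt : (t - a) / ρ < ⌊(t - a) / ρ⌋₊ + 1 := Nat.lt_floor_add_one _
  have hle : (⌊(t - a) / ρ⌋₊ : ℝ) ≤ (t - a) / ρ := Nat.floor_le ht'
  rw [div_lt_iff₀ hρ] at hlt
  rw [le_div_iff₀ hρ] at hle
  have hk : ⌊(t - a) / ρ⌋₊ ≤ ⌊ρ⁻¹⌋₊ := by
    rw [inv_eq_one_div]
    gcongr
    linarith [ht.2]
  exact mem_biUnion (Finset.mem_range.2 (Nat.lt_succ_of_le hk)) ⟨by linarith, by linarith⟩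

theorem mkMetric'_pre_prod_Icc_le (hd : 0 ≤ d + 1) (a : ℝ) {T : Set X} {r : ℝ≥0∞} {ρ : ℝ≥0}
    (hρ : 0 < ρ) (hρ1 : ρ ≤ 1) (hρr : ρ ≤ r) (hT : ediam T ≤ ρ) :
    OuterMeasure.mkMetric'.pre (fun s : Set (X × ℝ) => ediam s ^ (d + 1)) r
      (T ×ˢ Icc a (a + 1)) ≤ 2 * (ρ : ℝ≥0∞) ^ d := by
  set N := ⌊(ρ : ℝ)⁻¹⌋₊
  set I : ℕ → Set ℝ := fun k => Icc (a + k * ρ) (a + k * ρ + ρ) with hI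
  have hdiam (k : ℕ) : ediam (T ×ˢ I k) ≤ ρ := by
    refine ediam_le fun x hx y hy => max_le ((edist_le_ediam_of_mem hx.1 hy.1).trans hT) ?_
    refine (edist_le_ediam_of_mem hx.2 hy.2).trans ?_
    simp [hI, Real.ediam_Icc]
  have hcover : T ×ˢ Icc a (a + 1) ⊆ ⋃ k ∈ Finset.range (N + 1), T ×ˢ I k := by
    simp only [← prod_iUnion]
    exact prod_mono_right (Icc_subset_iUnion_Icc_mul a (NNReal.coe_pos.2 hρ))
  have hcount : ((N + 1 : ℕ) : ℝ≥0) * ρ ≤ 2 := by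
    have hfloor : (N : ℝ≥0) ≤ ρ⁻¹ := by exact_mod_cast Nat.floor_le (inv_nonneg.2 ρ.coe_nonneg)
    calc ((N + 1 : ℕ) : ℝ≥0) * ρ = N * ρ + ρ := by push_cast; ring
      _ ≤ ρ⁻¹ * ρ + 1 := by gcongr
      _ = 2 := by rw [inv_mul_cancel₀ hρ.ne', one_add_one_eq_two]
  have hρ0 : (ρ : ℝ≥0∞) ≠ 0 := ENNReal.coe_ne_zero.2 hρ.ne'
  calc _ ≤ ∑ k ∈ Finset.range (N + 1), OuterMeasure.mkMetric'.pre
          (fun s : Set (X × ℝ) => ediam s ^ (d + 1)) r (T ×ˢ I k) :=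
        (measure_mono hcover).trans (measure_biUnion_finset_le _ _)
    _ ≤ ∑ _k ∈ Finset.range (N + 1), (ρ : ℝ≥0∞) ^ (d + 1) := by
        gcongr with k
        exact (OuterMeasure.mkMetric'.pre_le ((hdiam k).trans hρr)).trans
          (ENNReal.rpow_le_rpow (hdiam k) hd)
    _ = (((N + 1 : ℕ) : ℝ≥0) * ρ : ℝ≥0) * (ρ : ℝ≥0∞) ^ d := by
        rw [Finset.sum_const, Finset.card_range, nsmul_eq_mul,
          ENNReal.rpow_add _ _ hρ0 ENNReal.coe_ne_top, ENNReal.rpow_one]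
        push_cast
        ring
    _ ≤ 2 * (ρ : ℝ≥0∞) ^ d := by
        gcongr
        exact_mod_cast hcount

theorem mkMetric'_pre_prod_Icc_le_ediam_rpow (hd : 0 ≤ d) (a : ℝ) {T : Set X} {r : ℝ≥0∞}
    (hT : ediam T < min r 1) :
    OuterMeasure.mkMetric'.pre (fun s : Set (X × ℝ) => ediam s ^ (d + 1)) r
      (T ×ˢ Icc a (a + 1)) ≤ 2 * ediam T ^ d := by
  have hlim : Tendsto (fun ρ : ℝ≥0∞ => 2 * ρ ^ d) (𝓝[>] ediam T) (𝓝 (2 * ediam T ^ d)) :=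
    (ENNReal.Tendsto.const_mul (ENNReal.continuous_rpow_const.tendsto _)
      (Or.inr ENNReal.ofNat_ne_top)).mono_left nhdsWithin_le_nhds
  have : (𝓝[>] ediam T).NeBot := nhdsGT_neBot_of_exists_gt ⟨_, hT⟩
  -- Every `ρ > ediam T` is a positive scale, which `ediam T` itself need not be.
  refine ge_of_tendsto hlim ?_
  filter_upwards [Ioo_mem_nhdsGT hT] with ρ hρ
  lift ρ to ℝ≥0 using (hρ.2.trans_le (min_le_right r 1)).ne_top
  obtain ⟨hρr, hρ1⟩ := lt_min_iff.1 hρ.2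
  exact mkMetric'_pre_prod_Icc_le (by positivity) a (ENNReal.coe_pos.1 (bot_le.trans_lt hρ.1))
    (by exact_mod_cast hρ1.le) hρr.le hρ.1.le

variable [MeasurableSpace X] [BorelSpace X]

theorem hausdorffMeasure_prod_Icc_le (hd : 0 ≤ d) (a : ℝ) (A : Set X) :
    μH[d + 1] (A ×ˢ Icc a (a + 1)) ≤ 2 * μH[d] A := by
  have hpre (r : ℝ≥0∞) (hr : 0 < r) :
      OuterMeasure.mkMetric'.pre (fun s : Set (X × ℝ) => ediam s ^ (d + 1)) r
        (A ×ˢ Icc a (a + 1)) ≤ 2 * μH[d] A := by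
    set ν := OuterMeasure.mkMetric'.pre (fun s : Set (X × ℝ) => ediam s ^ (d + 1)) r
    obtain ⟨q, hq0, hq⟩ := exists_between (lt_min hr one_pos)
    -- Half of `T ↦ ν (T × [a, a + 1])` is an outer measure below the gauge `ediam T ^ d`.
    set lam : OuterMeasure X := (2⁻¹ : ℝ≥0∞) • OuterMeasure.map Prod.fst
      (OuterMeasure.restrict (univ ×ˢ Icc a (a + 1)) ν)
    have hlam (T : Set X) : lam T = 2⁻¹ * ν (T ×ˢ Icc a (a + 1)) := by
      simp [lam, ← prod_univ, prod_inter_prod]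
    have hle : lam A ≤ μH[d] A := by
      rw [Measure.hausdorffMeasure, ← OuterMeasure.coe_mkMetric]
      refine OuterMeasure.le_mkMetric _ lam q hq0 (fun T hT => ?_) A
      rw [hlam, ENNReal.inv_mul_le_iff two_ne_zero ENNReal.ofNat_ne_top]
      exact mkMetric'_pre_prod_Icc_le_ediam_rpow hd a (hT.trans_lt hq)
    rwa [hlam, ENNReal.inv_mul_le_iff two_ne_zero ENNReal.ofNat_ne_top] at hle
  rw [Measure.hausdorffMeasure, ← OuterMeasure.coe_mkMetric, OuterMeasure.mkMetric,
    OuterMeasure.mkMetric']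
  simp only [OuterMeasure.iSup_apply]
  exact iSup₂_le hpre

theorem hausdorffMeasure_prod_univ_eq_zero (hd : 0 ≤ d) {A : Set X}
    (hA : μH[d] A = 0) :
    μH[d + 1] (A ×ˢ (univ : Set ℝ)) = 0 := by
  rw [← iUnion_Icc_intCast ℝ, prod_iUnion, measure_iUnion_null_iff]
  intro k
  simpa [hA] using hausdorffMeasure_prod_Icc_le hd (k : ℝ) A

end HausdorffProduct

theorem hausdorffMeasure_image_eq_zero {X Y : Type*} [EMetricSpace X] [MeasurableSpace X]
    [BorelSpace X] [SecondCountableTopology X] [EMetricSpace Y] [MeasurableSpace Y] [BorelSpace Y]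
    {d : ℝ} (hd : 0 ≤ d) {φ : X → Y} {S : Set X} (hφ : LocallyLipschitzOn S φ)
    (hS : μH[d] S = 0) : μH[d] (φ '' S) = 0 := by
  choose! K t ht hK using fun x hx => hφ (x := x) hx
  obtain ⟨D, hDS, hD, hcover⟩ := TopologicalSpace.countable_cover_nhdsWithin ht
  have hsub : φ '' S ⊆ ⋃ x ∈ D, φ '' (t x ∩ S) := by
    rw [← image_iUnion₂, ← iUnion₂_inter]
    exact image_mono (subset_inter hcover subset_rfl)
  refine measure_mono_null hsub ((measure_biUnion_null_iff hD).2 fun x hx => ?_)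
  have hle := ((hK x (hDS hx)).mono inter_subset_left).hausdorffMeasure_image_le (s := t x ∩ S) hd
  rw [measure_mono_null inter_subset_right hS, mul_zero] at hle
  exact nonpos_iff_eq_zero.1 hle

section RealHaar

variable {V : Type*} [NormedAddCommGroup V] [NormedSpace ℝ V] [FiniteDimensional ℝ V]
  [MeasurableSpace V] [BorelSpace V] (μ : Measure V) [μ.IsAddHaarMeasure]

theorem measure_eq_zero_of_hausdorffMeasure_finrank {S : Set V} (hS : μH[finrank ℝ V] S = 0) :
    μ S = 0 :=
  Measure.absolutelyContinuous_isAddHaarMeasure μ (μH[finrank ℝ V]) hS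

theorem measure_eq_zero_of_hausdorffMeasure_finrank_sub_one {S : Set V}
    (hS : μH[finrank ℝ V - 1] S = 0) : μ S = 0 :=
  measure_eq_zero_of_hausdorffMeasure_finrank μ <| nonpos_iff_eq_zero.1 <|
    (Measure.hausdorffMeasure_mono (by linarith) S).trans hS.le

variable {F : Type*} [NormedAddCommGroup F] [NormedSpace ℝ F] {g : V → F} {z : V} {ρ R : ℝ}

theorem continuousAt_setAverage_closedBall (hρ : 0 < ρ) (hρR : ρ < R)
    (hg : IntegrableOn g (closedBall z R) μ) :
    ContinuousAt (fun y => ⨍ x in closedBall y ρ, g x ∂μ) z := by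
  simp only [setAverage_eq, Measure.addHaar_real_closedBall_center μ _ ρ,
    ← integral_indicator measurableSet_closedBall]
  have hsub : ∀ᶠ y in 𝓝 z, closedBall y ρ ⊆ closedBall z R := by
    filter_upwards [closedBall_mem_nhds z (sub_pos.2 hρR)] with y hy
    exact closedBall_subset_closedBall' (by linarith [mem_closedBall.1 hy])
  refine (tendsto_integral_filter_of_dominated_convergence
    ((closedBall z R).indicator fun x => ‖g x‖) ?_ ?_ ?_ ?_).const_smul _
  · filter_upwards [hsub] with y hy
    exact (aestronglyMeasurable_indicator_iff measurableSet_closedBall).2 (hg.mono_set hy).1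
  · filter_upwards [hsub] with y hy
    filter_upwards with x
    rw [norm_indicator_eq_indicator_norm]
    exact indicator_le_indicator_of_subset hy (fun _ => norm_nonneg _) x
  · exact (integrable_indicator_iff measurableSet_closedBall).2 hg.norm
  · have hsphere : μ (sphere z ρ) = 0 := Measure.addHaar_sphere_of_ne_zero μ z hρ.ne'
    filter_upwards [measure_eq_zero_iff_ae_notMem.1 hsphere] with x hx
    have hdist : ContinuousAt (dist x) z := (continuous_const.dist continuous_id).continuousAt
    refine tendsto_const_nhds.congr' ?_
    rcases lt_or_gt_of_ne (mt mem_sphere.2 hx) with h | h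
    · filter_upwards [hdist.eventually_lt_const h] with y hy
      rw [indicator_of_mem (mem_closedBall.2 h.le), indicator_of_mem (mem_closedBall.2 hy.le)]
    · filter_upwards [hdist.eventually_const_lt h] with y hy
      rw [indicator_of_notMem (mt mem_closedBall.1 h.not_ge),
        indicator_of_notMem (mt mem_closedBall.1 hy.not_ge)]

theorem tendsto_setAverage_closedBall [CompleteSpace F] (hg : ∀ᶠ x in 𝓝 z, ContinuousAt g x) :
    Tendsto (fun r => ⨍ x in closedBall z r, g x ∂μ) (𝓝[>] 0) (𝓝 (g z)) := by
  refine nhds_basis_closedBall.tendsto_right_iff.2 fun ε hε => ?_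
  obtain ⟨δ, hδ, hball⟩ := nhds_basis_closedBall.eventually_iff.1
    (hg.and (hg.self_of_nhds.eventually (closedBall_mem_nhds _ hε)))
  filter_upwards [Ioc_mem_nhdsGT hδ] with r hr
  have hsub : closedBall z r ⊆ closedBall z δ := closedBall_subset_closedBall hr.2
  have hcont : ContinuousOn g (closedBall z r) :=
    continuousOn_of_forall_continuousAt fun x hx => (hball (hsub hx)).1
  refine (convex_closedBall (g z) ε).set_average_mem isClosed_closedBall
    (measure_closedBall_pos μ z hr.1).ne' measure_closedBall_lt_top.ne ?_
    (hcont.integrableOn_compact (isCompact_closedBall z r))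
  filter_upwards [ae_restrict_mem measurableSet_closedBall] with x hx using (hball (hsub hx)).2

end RealHaar

theorem setAverage_clm_apply {α G F : Type*} [MeasurableSpace α] {μ : Measure α}
    [NormedAddCommGroup G] [NormedSpace ℂ G] [NormedAddCommGroup F] [NormedSpace ℂ F]
    {A : α → G →L[ℂ] F} {s : Set α} (hA : IntegrableOn A s μ) (v : G) :
    ⨍ x in s, A x v ∂μ = (⨍ x in s, A x ∂μ) v := by
  rw [setAverage_eq, setAverage_eq, ← ContinuousLinearMap.integral_apply hA,
    smul_apply]

section AddSmul

variable {V : Type*} [NormedAddCommGroup V] [NormedSpace ℂ V]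

theorem preimage_add_smul_closedBall (z : V) {c : ℂ} (hc : c ≠ 0) :
    (fun w => z + c • w) ⁻¹' closedBall z ‖c‖ = closedBall 0 1 := by
  ext w
  simp [norm_smul, hc]

variable [MeasurableSpace V] [BorelSpace V]

theorem measurableEmbedding_add_smul (z : V) {c : ℂ} (hc : c ≠ 0) :
    MeasurableEmbedding (fun w => z + c • w) :=
  ((Homeomorph.smulOfNeZero c hc).trans (Homeomorph.addLeft z)).measurableEmbedding

variable [FiniteDimensional ℂ V] (μ : Measure V) [μ.IsAddHaarMeasure]

theorem map_add_smul_addHaar (z : V) {c : ℂ} (hc : c ≠ 0) :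
    μ.map (fun w => z + c • w) = ENNReal.ofReal (‖c‖ ^ finrank ℝ V)⁻¹ • μ := by
  set L : V →ₗ[ℝ] V := (c • LinearMap.id : V →ₗ[ℂ] V).restrictScalars ℝ with hL
  have hdet : |L.det| = ‖c‖ ^ finrank ℝ V := by
    rw [hL, LinearMap.det_restrictScalars, LinearMap.det_smul, LinearMap.det_id, mul_one,
      Algebra.norm_complex_apply, Complex.normSq_eq_norm_sq, finrank_real_of_complex,
      pow_mul, norm_pow, abs_of_nonneg (by positivity), ← pow_mul, ← pow_mul, mul_comm]
  have hdet0 : L.det ≠ 0 := abs_ne_zero.1 (by rw [hdet]; positivity)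
  have hmap := Measure.map_linearMap_addHaar_eq_smul_addHaar μ hdet0
  rw [abs_inv, hdet] at hmap
  rw [← hmap, show (fun w => z + c • w) = (z + ·) ∘ L from rfl, ← Measure.map_map
    (measurable_const_add z) L.continuous_of_finiteDimensional.measurable, hmap, Measure.map_smul,
    map_add_left_eq_self]

theorem map_add_smul_restrict_closedBall (z : V) {c : ℂ} (hc : c ≠ 0) :
    (μ.restrict (closedBall 0 1)).map (fun w => z + c • w) =
      ENNReal.ofReal (‖c‖ ^ finrank ℝ V)⁻¹ • μ.restrict (closedBall z ‖c‖) := by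
  rw [← Measure.restrict_smul, ← map_add_smul_addHaar μ z hc,
    (measurableEmbedding_add_smul z hc).restrict_map, preimage_add_smul_closedBall z hc]

theorem setLIntegral_comp_add_smul (g : V → ℝ≥0∞) (z : V) {c : ℂ} (hc : c ≠ 0) :
    ∫⁻ w in closedBall 0 1, g (z + c • w) ∂μ =
      ENNReal.ofReal (‖c‖ ^ finrank ℝ V)⁻¹ * ∫⁻ x in closedBall z ‖c‖, g x ∂μ := by
  rw [← (measurableEmbedding_add_smul z hc).lintegral_map, map_add_smul_restrict_closedBall μ z hc,
    lintegral_smul_measure, smul_eq_mul]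

variable {F : Type*} [NormedAddCommGroup F]

theorem integrableOn_comp_add_smul_iff {h : V → F} (z : V) {c : ℂ} (hc : c ≠ 0) :
    IntegrableOn (fun w => h (z + c • w)) (closedBall 0 1) μ ↔
      IntegrableOn h (closedBall z ‖c‖) μ := by
  have hpos : 0 < (‖c‖ ^ finrank ℝ V)⁻¹ := by positivity
  rw [IntegrableOn, IntegrableOn, ← integrable_smul_measure (f := h) (ENNReal.ofReal_pos.2 hpos).ne'
    ENNReal.ofReal_ne_top, ← map_add_smul_restrict_closedBall μ z hc,
    (measurableEmbedding_add_smul z hc).integrable_map_iff, comp_def]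

theorem setAverage_comp_add_smul [NormedSpace ℝ F] (h : V → F) (z : V) {c : ℂ} (hc : c ≠ 0) :
    ⨍ w in closedBall 0 1, h (z + c • w) ∂μ = ⨍ x in closedBall z ‖c‖, h x ∂μ := by
  rw [setAverage_eq, setAverage_eq, ← (measurableEmbedding_add_smul z hc).integral_map,
    map_add_smul_restrict_closedBall μ z hc, integral_smul_measure, smul_smul,
    ENNReal.toReal_ofReal (by positivity), Measure.addHaar_real_closedBall' μ z (norm_nonneg c),
    mul_inv_rev]

theorem ae_forall_add_smul_notMem [Nontrivial V] {E : Set V}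
    (hE : μH[finrank ℝ V - 1] E = 0) {p : ℝ → V} {c : ℝ → ℂ} (hp : ContDiff ℝ 1 p)
    (hc : ContDiff ℝ 1 c) : ∀ᵐ w ∂μ, ∀ s, c s ≠ 0 → p s + c s • w ∉ E := by
  set φ : V × ℝ → V := fun y => (c y.2)⁻¹ • (y.1 - p y.2)
  have hφ : LocallyLipschitzOn (E ×ˢ {s | c s ≠ 0}) φ := fun y hy => by
    have hφy : ContDiffAt ℝ 1 φ y :=
      (hc.contDiffAt.comp y contDiffAt_snd |>.inv hy.2).smul
        (contDiffAt_fst.sub (hp.contDiffAt.comp y contDiffAt_snd))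
    obtain ⟨K, t, ht, hK⟩ := hφy.exists_lipschitzOnWith
    exact ⟨K, t, mem_nhdsWithin_of_mem_nhds ht, hK⟩
  have hprod : μH[finrank ℝ V] (E ×ˢ {s | c s ≠ 0}) = 0 := by
    have hdim : (0 : ℝ) ≤ finrank ℝ V - 1 := sub_nonneg.2 (by exact_mod_cast finrank_pos)
    have hnull := hausdorffMeasure_prod_univ_eq_zero hdim hE
    rw [sub_add_cancel] at hnull
    exact measure_mono_null (prod_mono_right (subset_univ _)) hnull
  have hnull := measure_eq_zero_of_hausdorffMeasure_finrank μ
    (hausdorffMeasure_image_eq_zero (Nat.cast_nonneg _) hφ hprod)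
  refine ae_iff.2 (measure_mono_null (fun w hw => ?_) hnull)
  push Not at hw
  obtain ⟨s, hs, hmem⟩ := hw
  exact ⟨(p s + c s • w, s), ⟨hmem, hs⟩, by simp [φ, inv_smul_smul₀ hs]⟩

end AddSmul

/-- A `C¹` family `w ↦ p s + c s • w`, `‖w‖ ≤ 1`, of parametrized closed balls in `K`, where `s`
runs through the interval `[a, b]`. The scale `c s` is a complex number so that the family may also
rotate a ball about its centre. -/
structure IsC1BallFamily {V : Type*} [NormedAddCommGroup V] [NormedSpace ℂ V] (p : ℝ → V)
    (c : ℝ → ℂ) (a b : ℝ) (K : Set V) : Prop where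
  contDiff_center : ContDiff ℝ 1 p
  contDiff_scale : ContDiff ℝ 1 c
  le : a ≤ b
  scale_ne_zero : ∀ s ∈ Icc a b, c s ≠ 0
  closedBall_subset : ∀ s ∈ Icc a b, closedBall (p s) ‖c s‖ ⊆ K

namespace IsC1BallFamily

variable {V : Type*} [NormedAddCommGroup V] [NormedSpace ℂ V] {p : ℝ → V} {c : ℝ → ℂ} {a b : ℝ}
  {K : Set V}

theorem hasDerivAt (h : IsC1BallFamily p c a b K) (w : V) (s : ℝ) :
    HasDerivAt (fun s => p s + c s • w) (deriv p s + deriv c s • w) s :=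
  (h.contDiff_center.differentiable one_ne_zero s).hasDerivAt.add
    ((h.contDiff_scale.differentiable one_ne_zero s).hasDerivAt.smul_const w)

theorem continuous_uncurry (h : IsC1BallFamily p c a b K) :
    Continuous fun y : V × ℝ => p y.2 + c y.2 • y.1 := by
  have := h.contDiff_center.continuous
  have := h.contDiff_scale.continuous
  fun_prop

theorem continuous_uncurry_deriv (h : IsC1BallFamily p c a b K) :
    Continuous fun y : V × ℝ => deriv p y.2 + deriv c y.2 • y.1 := by
  have := h.contDiff_center.continuous_deriv_one
  have := h.contDiff_scale.continuous_deriv_one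
  fun_prop

theorem add_smul_mem (h : IsC1BallFamily p c a b K) {w : V} (hw : w ∈ closedBall 0 1) {s : ℝ}
    (hs : s ∈ Icc a b) : p s + c s • w ∈ K :=
  h.closedBall_subset s hs <| by
    rw [← preimage_add_smul_closedBall (p s) (h.scale_ne_zero s hs)] at hw
    exact hw

variable [MeasurableSpace V] [BorelSpace V] [FiniteDimensional ℂ V] (μ : Measure V)
  [μ.IsAddHaarMeasure] {F : Type*} [NormedAddCommGroup F]

theorem integrable_prod_comp (h : IsC1BallFamily p c a b K) {g : V → F}
    (hg : StronglyMeasurable g) (hgK : IntegrableOn g K μ) :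
    Integrable (fun y : V × ℝ => g (p y.2 + c y.2 • y.1))
      ((μ.restrict (closedBall 0 1)).prod (volume.restrict (Icc a b))) := by
  have hscale : ContinuousOn (fun s => (‖c s‖ ^ finrank ℝ V)⁻¹) (Icc a b) :=
    (h.contDiff_scale.continuous.norm.pow _).continuousOn.inv₀ fun s hs =>
      pow_ne_zero _ (norm_ne_zero_iff.2 (h.scale_ne_zero s hs))
  obtain ⟨C, hC⟩ := isCompact_Icc.bddAbove_image hscale
  have hslice : ∀ s ∈ Icc a b, ∫⁻ w in closedBall 0 1, ‖g (p s + c s • w)‖ₑ ∂μ ≤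
      ENNReal.ofReal C * ∫⁻ x in K, ‖g x‖ₑ ∂μ := fun s hs => by
    rw [setLIntegral_comp_add_smul μ (fun x => ‖g x‖ₑ) (p s) (h.scale_ne_zero s hs)]
    gcongr
    · exact hC (mem_image_of_mem _ hs)
    · exact h.closedBall_subset s hs
  have hmeas : StronglyMeasurable fun y : V × ℝ => g (p y.2 + c y.2 • y.1) :=
    hg.comp_measurable h.continuous_uncurry.measurable
  refine ⟨hmeas.aestronglyMeasurable, ?_⟩
  rw [hasFiniteIntegral_iff_enorm, lintegral_prod_symm _ hmeas.enorm.aemeasurable]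
  calc _ ≤ ∫⁻ _s in Icc a b, ENNReal.ofReal C * ∫⁻ x in K, ‖g x‖ₑ ∂μ :=
        setLIntegral_mono' measurableSet_Icc hslice
    _ < ∞ := by
        rw [setLIntegral_const]
        exact ENNReal.mul_lt_top (ENNReal.mul_lt_top ENNReal.ofReal_lt_top hgK.2)
          measure_Icc_lt_top

variable [NormedSpace ℂ F] [CompleteSpace F] [SecondCountableTopology F] {f : V → F}

theorem integrable_prod_fderiv (h : IsC1BallFamily p c a b K)
    (hfK : IntegrableOn (fderiv ℂ f) K μ) :
    Integrable
      (fun y : V × ℝ => fderiv ℂ f (p y.2 + c y.2 • y.1) (deriv p y.2 + deriv c y.2 • y.1))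
      ((μ.restrict (closedBall 0 1)).prod (volume.restrict (Icc a b))) := by
  have hmeas : StronglyMeasurable (fderiv ℂ f) := (measurable_fderiv ℂ f).stronglyMeasurable
  have hcompact : IsCompact (closedBall (0 : V) 1 ×ˢ Icc a b) :=
    (isCompact_closedBall 0 1).prod isCompact_Icc
  obtain ⟨C, hC⟩ := hcompact.exists_bound_of_continuousOn h.continuous_uncurry_deriv.continuousOn
  refine ((h.integrable_prod_comp μ hmeas hfK).norm.const_mul C).mono' ?_ ?_
  · exact (isBoundedBilinearMap_apply.continuous.comp_stronglyMeasurable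
      ((hmeas.comp_measurable h.continuous_uncurry.measurable).prodMk
        h.continuous_uncurry_deriv.stronglyMeasurable)).aestronglyMeasurable
  · rw [Measure.prod_restrict]
    filter_upwards [ae_restrict_mem hcompact.measurableSet] with y hy
    rw [mul_comm]
    exact ContinuousLinearMap.le_opNorm_of_le _ (hC y hy)

theorem ae_intervalIntegral_fderiv_eq_sub [Nontrivial V] (h : IsC1BallFamily p c a b K)
    {E : Set V} (hE : μH[finrank ℝ V - 1] E = 0) (hf : ∀ x ∈ K \ E, DifferentiableAt ℂ f x)
    (hfK : IntegrableOn (fderiv ℂ f) K μ) :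
    ∀ᵐ w ∂μ.restrict (closedBall 0 1),
      ∫ s in a..b, fderiv ℂ f (p s + c s • w) (deriv p s + deriv c s • w) =
        f (p b + c b • w) - f (p a + c a • w) := by
  filter_upwards [ae_restrict_mem measurableSet_closedBall,
    ae_restrict_of_ae (ae_forall_add_smul_notMem μ hE h.contDiff_center h.contDiff_scale),
    (h.integrable_prod_fderiv μ hfK).prod_right_ae] with w hw hwE hint
  refine intervalIntegral.integral_eq_sub_of_hasDerivAt (f := fun s => f (p s + c s • w))
    (fun s hs => ?_) ?_
  · rw [uIcc_of_le h.le] at hs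
    have hdiff := hf _ ⟨h.add_smul_mem hw hs, hwE s (h.scale_ne_zero s hs)⟩
    exact (hdiff.hasFDerivAt.restrictScalars ℝ).comp_hasDerivAt s (h.hasDerivAt w s)
  · exact (intervalIntegrable_iff_integrableOn_Icc_of_le h.le).2 hint

theorem integrableOn_closedBall_right [Nontrivial V] (h : IsC1BallFamily p c a b K)
    {E : Set V} (hE : μH[finrank ℝ V - 1] E = 0) (hf : ∀ x ∈ K \ E, DifferentiableAt ℂ f x)
    (hfK : IntegrableOn (fderiv ℂ f) K μ) (ha : IntegrableOn f (closedBall (p a) ‖c a‖) μ) :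
    IntegrableOn f (closedBall (p b) ‖c b‖) μ := by
  rw [← integrableOn_comp_add_smul_iff μ _ (h.scale_ne_zero a (left_mem_Icc.2 h.le))] at ha
  rw [← integrableOn_comp_add_smul_iff μ _ (h.scale_ne_zero b (right_mem_Icc.2 h.le))]
  refine (ha.add (h.integrable_prod_fderiv μ hfK).integral_prod_left).congr ?_
  filter_upwards [h.ae_intervalIntegral_fderiv_eq_sub μ hE hf hfK] with w hw
  rw [intervalIntegral.integral_of_le h.le, ← integral_Icc_eq_integral_Ioc] at hw
  exact (congrArg (f (p a + c a • w) + ·) hw).trans (add_sub_cancel _ _)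

theorem intervalIntegral_setAverage_fderiv [Nontrivial V] (h : IsC1BallFamily p c a b K)
    {E : Set V} (hE : μH[finrank ℝ V - 1] E = 0) (hf : ∀ x ∈ K \ E, DifferentiableAt ℂ f x)
    (hfK : IntegrableOn (fderiv ℂ f) K μ) (ha : IntegrableOn f (closedBall (p a) ‖c a‖) μ) :
    ∫ s in a..b, ⨍ w in closedBall 0 1,
        fderiv ℂ f (p s + c s • w) (deriv p s + deriv c s • w) ∂μ =
      (⨍ x in closedBall (p b) ‖c b‖, f x ∂μ) - ⨍ x in closedBall (p a) ‖c a‖, f x ∂μ := by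
  have hca := h.scale_ne_zero a (left_mem_Icc.2 h.le)
  have hcb := h.scale_ne_zero b (right_mem_Icc.2 h.le)
  have hb := h.integrableOn_closedBall_right μ hE hf hfK ha
  rw [← integrableOn_comp_add_smul_iff μ _ hca] at ha
  rw [← integrableOn_comp_add_smul_iff μ _ hcb] at hb
  calc _ = (μ.real (closedBall 0 1))⁻¹ • ∫ w in closedBall 0 1, (∫ s in a..b,
        fderiv ℂ f (p s + c s • w) (deriv p s + deriv c s • w)) ∂μ := by
        simp only [setAverage_eq, intervalIntegral.integral_of_le h.le,
          ← integral_Icc_eq_integral_Ioc]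
        rw [integral_integral_swap (h.integrable_prod_fderiv μ hfK), integral_smul]
    _ = (μ.real (closedBall 0 1))⁻¹ •
          ∫ w in closedBall 0 1, (f (p b + c b • w) - f (p a + c a • w)) ∂μ := by
        rw [integral_congr_ae (h.ae_intervalIntegral_fderiv_eq_sub μ hE hf hfK)]
    _ = _ := by
        rw [integral_sub hb ha, smul_sub, ← setAverage_eq, ← setAverage_eq,
          setAverage_comp_add_smul μ f _ hca, setAverage_comp_add_smul μ f _ hcb]

end IsC1BallFamily

section IsC1BallFamily

variable {V : Type*} [NormedAddCommGroup V] [NormedSpace ℂ V]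

theorem isC1BallFamily_radial (z : V) {a ρ : ℝ} (ha : 0 < a) (haρ : a ≤ ρ) :
    IsC1BallFamily (fun _ => z) (fun s => (s : ℂ)) a ρ (closedBall z ρ) where
  contDiff_center := contDiff_const
  contDiff_scale := Complex.ofRealCLM.contDiff
  le := haρ
  scale_ne_zero _ hs := Complex.ofReal_ne_zero.2 (ha.trans_le hs.1).ne'
  closedBall_subset s hs := closedBall_subset_closedBall <| by
    rw [Complex.norm_real, Real.norm_of_nonneg (ha.le.trans hs.1)]
    exact hs.2

theorem isC1BallFamily_rotation (z : V) {τ : ℝ} (hτ : 0 < τ) :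
    IsC1BallFamily (fun _ => z) (circleMap 0 τ) 0 (2 * Real.pi) (closedBall z τ) where
  contDiff_center := contDiff_const
  contDiff_scale := contDiff_circleMap 0 τ
  le := Real.two_pi_pos.le
  scale_ne_zero _ _ := circleMap_ne_center hτ.ne'
  closedBall_subset s _ := by rw [norm_circleMap_zero, abs_of_pos hτ]

theorem isC1BallFamily_translation {z v : V} {ρ : ℝ} (hρ : 0 < ρ) {K : Set V}
    (hK : ∀ s ∈ Icc (0 : ℝ) 1, closedBall (z + s • v) ρ ⊆ K) :
    IsC1BallFamily (fun s => z + s • v) (fun _ => (ρ : ℂ)) 0 1 K where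
  contDiff_center := contDiff_const.add (contDiff_id.smul contDiff_const)
  contDiff_scale := contDiff_const
  le := zero_le_one
  scale_ne_zero _ _ := Complex.ofReal_ne_zero.2 hρ.ne'
  closedBall_subset s hs := by
    rw [Complex.norm_real, Real.norm_of_nonneg hρ.le]
    exact hK s hs

end IsC1BallFamily

theorem exists_differentiableOn_eqOn_of_forall_exists_ball {𝕜 V F : Type*}
    [NontriviallyNormedField 𝕜] [NormedAddCommGroup V] [NormedSpace 𝕜 V] [NormedAddCommGroup F]
    [NormedSpace 𝕜 F] {f : V → F} {S Ω : Set V} (hΩ : Ω ⊆ closure S) (hf : ContinuousOn f S)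
    (hloc : ∀ z ∈ Ω, ∃ r > 0, ball z r ⊆ Ω ∧
      ∃ G : V → F, DifferentiableOn 𝕜 G (ball z r) ∧ EqOn G f (ball z r ∩ S)) :
    ∃ G : V → F, DifferentiableOn 𝕜 G Ω ∧ EqOn G f S := by
  refine ⟨extendFrom S f, fun z hz => ?_, fun z hz =>
    extendFrom_eq (subset_closure hz) (hf z hz)⟩
  obtain ⟨r, hr, hsub, G, hG, heq⟩ := hloc z hz
  have hextend : EqOn (extendFrom S f) G (ball z r) := fun x hx => by
    have hGx : ContinuousAt G x := (hG.differentiableAt (isOpen_ball.mem_nhds hx)).continuousAt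
    refine extendFrom_eq (hΩ (hsub hx)) (hGx.continuousWithinAt.tendsto.congr' ?_)
    filter_upwards [mem_nhdsWithin_of_mem_nhds (isOpen_ball.mem_nhds hx), self_mem_nhdsWithin]
      with y hy hyS using heq ⟨hy, hyS⟩
  exact ((hG.congr hextend).differentiableAt (ball_mem_nhds z hr)).differentiableWithinAt

theorem isOpen_sdiff_of_isClosed_preimage_val {X : Type*} [TopologicalSpace X] {Ω E : Set X}
    (hΩ : IsOpen Ω) (hE : IsClosed ((↑) ⁻¹' E : Set Ω)) : IsOpen (Ω \ E) := by
  have := hΩ.isOpenMap_subtype_val _ hE.isOpen_compl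
  rwa [← preimage_compl, Subtype.image_preimage_coe, ← sdiff_eq] at this

section MeanValue

variable {V : Type*} [NormedAddCommGroup V] [NormedSpace ℂ V] [FiniteDimensional ℂ V]
  [MeasurableSpace V] [BorelSpace V] (μ : Measure V) [μ.IsAddHaarMeasure]
  {F : Type*} [NormedAddCommGroup F] [NormedSpace ℂ F] {f : V → F}

theorem setAverage_fderiv_apply_smul (f : V → F) (z : V) {c : ℂ} (hc : c ≠ 0) (c' : ℂ) :
    ⨍ w in closedBall 0 1, fderiv ℂ f (z + c • w) (c' • w) ∂μ =
      (c' / c) • ⨍ x in closedBall z ‖c‖, fderiv ℂ f x (x - z) ∂μ := by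
  rw [← setAverage_comp_add_smul μ (fun x => fderiv ℂ f x (x - z)) z hc, setAverage_eq,
    setAverage_eq, smul_comm, ← integral_smul (c' / c)]
  simp only [add_sub_cancel_left, map_smul, smul_smul, div_mul_cancel₀ _ hc]

variable [CompleteSpace F] [SecondCountableTopology F] [Nontrivial V] {E : Set V} {z v : V}
  {ρ R : ℝ}

theorem setAverage_fderiv_apply_sub_eq_zero (hE : μH[finrank ℝ V - 1] E = 0) {τ : ℝ}
    (hτ : 0 < τ) (hf : ∀ x ∈ closedBall z τ \ E, DifferentiableAt ℂ f x)
    (hfint : IntegrableOn f (closedBall z τ) μ)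
    (hf' : IntegrableOn (fderiv ℂ f) (closedBall z τ) μ) :
    ⨍ x in closedBall z τ, fderiv ℂ f x (x - z) ∂μ = 0 := by
  have hnorm (s : ℝ) : ‖circleMap 0 τ s‖ = τ := by rw [norm_circleMap_zero, abs_of_pos hτ]
  have hslice (s : ℝ) : ⨍ w in closedBall 0 1, fderiv ℂ f (z + circleMap 0 τ s • w)
      (deriv (fun _ => z) s + deriv (circleMap 0 τ) s • w) ∂μ =
        Complex.I • ⨍ x in closedBall z τ, fderiv ℂ f x (x - z) ∂μ := by
    have hc : circleMap 0 τ s ≠ 0 := circleMap_ne_center hτ.ne'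
    simp only [deriv_const, zero_add, deriv_circleMap]
    rw [setAverage_fderiv_apply_smul μ f z hc, mul_div_cancel_left₀ _ hc, hnorm]
  have hrot := (isC1BallFamily_rotation z hτ).intervalIntegral_setAverage_fderiv μ hE hf hf'
    (by rwa [hnorm])
  simp only [hslice, hnorm, sub_self, intervalIntegral.integral_const, sub_zero] at hrot
  simpa [Real.pi_ne_zero] using hrot

theorem integrableOn_closedBall_of_eventually_continuousAt
    (hE : μH[finrank ℝ V - 1] E = 0) (hf : ∀ x ∈ closedBall z ρ \ E, DifferentiableAt ℂ f x)
    (hf' : IntegrableOn (fderiv ℂ f) (closedBall z ρ) μ) (hz : ∀ᶠ x in 𝓝 z, ContinuousAt f x) :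
    IntegrableOn f (closedBall z ρ) μ := by
  obtain ⟨δ, hδ, hcont⟩ := nhds_basis_closedBall.eventually_iff.1 hz
  have hsmall : IntegrableOn f (closedBall z δ) μ :=
    (continuousOn_of_forall_continuousAt hcont).integrableOn_compact (isCompact_closedBall z δ)
  rcases le_total ρ δ with hρδ | hδρ
  · exact hsmall.mono_set (closedBall_subset_closedBall hρδ)
  · have := (isC1BallFamily_radial z hδ hδρ).integrableOn_closedBall_right μ hE hf hf'
    simp only [Complex.norm_real, Real.norm_of_nonneg hδ.le,
      Real.norm_of_nonneg (hδ.le.trans hδρ)] at this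
    exact this hsmall

theorem setAverage_closedBall_eq (hE : μH[finrank ℝ V - 1] E = 0) (hρ : 0 < ρ)
    (hf : ∀ x ∈ closedBall z ρ \ E, DifferentiableAt ℂ f x)
    (hf' : IntegrableOn (fderiv ℂ f) (closedBall z ρ) μ) (hz : ∀ᶠ x in 𝓝 z, ContinuousAt f x) :
    ⨍ x in closedBall z ρ, f x ∂μ = f z := by
  have hfint := integrableOn_closedBall_of_eventually_continuousAt μ hE hf hf' hz
  have hconst (a : ℝ) (ha : a ∈ Ioc 0 ρ) :
      ⨍ x in closedBall z a, f x ∂μ = ⨍ x in closedBall z ρ, f x ∂μ := by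
    have hzero : ∀ s ∈ uIcc a ρ, ⨍ w in closedBall 0 1, fderiv ℂ f (z + (s : ℂ) • w)
        (deriv (fun _ => z) s + deriv (fun t : ℝ => (t : ℂ)) s • w) ∂μ = 0 := fun s hs => by
      rw [uIcc_of_le ha.2] at hs
      have hs0 := ha.1.trans_le hs.1
      have hsub := closedBall_subset_closedBall (x := z) hs.2
      have hrot := setAverage_fderiv_apply_sub_eq_zero μ hE hs0 (fun x hx => hf x ⟨hsub hx.1, hx.2⟩)
        (hfint.mono_set hsub) (hf'.mono_set hsub)
      have hderiv : deriv (fun t : ℝ => (t : ℂ)) s = 1 := (hasDerivAt_id s).ofReal_comp.deriv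
      simp only [deriv_const, zero_add, hderiv]
      rw [setAverage_fderiv_apply_smul μ f z (Complex.ofReal_ne_zero.2 hs0.ne'), Complex.norm_real,
        Real.norm_of_nonneg hs0.le, hrot, smul_zero]
    have hrad := (isC1BallFamily_radial z ha.1 ha.2).intervalIntegral_setAverage_fderiv μ hE hf hf'
    simp only [intervalIntegral.integral_congr hzero, Complex.norm_real,
      Real.norm_of_nonneg ha.1.le, Real.norm_of_nonneg hρ.le,
      intervalIntegral.integral_zero] at hrad
    exact (sub_eq_zero.1 (hrad (hfint.mono_set (closedBall_subset_closedBall ha.2))).symm).symm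
  refine tendsto_nhds_unique (f := fun a => ⨍ x in closedBall z a, f x ∂μ) ?_
    (tendsto_setAverage_closedBall μ hz)
  refine tendsto_const_nhds.congr' ?_
  filter_upwards [Ioc_mem_nhdsGT hρ] with a ha using (hconst a ha).symm

theorem setAverage_closedBall_add_sub_eq_intervalIntegral (hE : μH[finrank ℝ V - 1] E = 0)
    (hρ : 0 < ρ) (hvR : ‖v‖ + ρ ≤ R)
    (hf : ∀ x ∈ closedBall z R \ E, DifferentiableAt ℂ f x)
    (hf' : IntegrableOn (fderiv ℂ f) (closedBall z R) μ)
    (hfint : IntegrableOn f (closedBall z ρ) μ) :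
    (⨍ x in closedBall (z + v) ρ, f x ∂μ) - ⨍ x in closedBall z ρ, f x ∂μ =
      ∫ s in (0 : ℝ)..1, (⨍ x in closedBall (z + s • v) ρ, fderiv ℂ f x ∂μ) v := by
  have hρ0 : (ρ : ℂ) ≠ 0 := Complex.ofReal_ne_zero.2 hρ.ne'
  have hnorm : ‖(ρ : ℂ)‖ = ρ := by rw [Complex.norm_real, Real.norm_of_nonneg hρ.le]
  have hsub : ∀ s ∈ Icc (0 : ℝ) 1, closedBall (z + s • v) ρ ⊆ closedBall z R := fun s hs => by
    refine closedBall_subset_closedBall' ?_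
    rw [dist_eq_norm, add_sub_cancel_left, norm_smul, Real.norm_of_nonneg hs.1]
    nlinarith [norm_nonneg v, hs.2]
  have hfam := (isC1BallFamily_translation hρ hsub).intervalIntegral_setAverage_fderiv μ hE hf hf'
    (by simpa [hnorm, abs_of_pos hρ] using hfint)
  simp only [hnorm, one_smul, zero_smul, add_zero] at hfam
  refine hfam.symm.trans (intervalIntegral.integral_congr fun s hs => ?_)
  rw [uIcc_of_le zero_le_one] at hs
  have hint := hf'.mono_set (hsub s hs)
  have hderiv : deriv (fun t : ℝ => z + t • v) s = v := by
    simpa using (((hasDerivAt_id s).smul_const v).const_add z).deriv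
  simp only [hderiv, deriv_const, zero_smul, add_zero]
  have hcov := setAverage_comp_add_smul μ (fun x => fderiv ℂ f x v) (z + s • v) hρ0
  rw [hnorm, setAverage_clm_apply hint] at hcov
  exact hcov

theorem hasFDerivAt_setAverage_closedBall (hE : μH[finrank ℝ V - 1] E = 0)
    (hρ : 0 < ρ) (hρR : ρ < R) (hf : ∀ x ∈ closedBall z R \ E, DifferentiableAt ℂ f x)
    (hf' : IntegrableOn (fderiv ℂ f) (closedBall z R) μ)
    (hfint : IntegrableOn f (closedBall z ρ) μ) :
    HasFDerivAt (fun y => ⨍ x in closedBall y ρ, f x ∂μ)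
      (⨍ x in closedBall z ρ, fderiv ℂ f x ∂μ) z := by
  set D : V → V →L[ℂ] F := fun y => ⨍ x in closedBall y ρ, fderiv ℂ f x ∂μ
  have hD : ∀ y ∈ ball z (R - ρ), ContinuousAt D y := fun y hy =>
    continuousAt_setAverage_closedBall μ hρ (R := R - dist y z) (by linarith [mem_ball.1 hy])
      (hf'.mono_set (closedBall_subset_closedBall' (by linarith)))
  rw [hasFDerivAt_iff_isLittleO_nhds_zero, Asymptotics.isLittleO_iff]
  intro ε hε
  obtain ⟨δ, hδ, hDδ⟩ := Metric.eventually_nhds_iff_ball.1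
    ((hD z (mem_ball_self (sub_pos.2 hρR))).eventually (closedBall_mem_nhds _ hε))
  filter_upwards [ball_mem_nhds 0 (lt_min hδ (sub_pos.2 hρR))] with v hv
  obtain ⟨hvδ, hvR⟩ := lt_min_iff.1 (mem_ball_zero_iff.1 hv)
  have hmem : ∀ s ∈ Icc (0 : ℝ) 1, ‖s • v‖ ≤ ‖v‖ := fun s hs => by
    rw [norm_smul, Real.norm_of_nonneg hs.1]
    exact mul_le_of_le_one_left (norm_nonneg v) hs.2
  have hcont : ContinuousOn (fun s : ℝ => D (z + s • v) v) (Icc 0 1) := fun s hs => by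
    have hline : ContinuousAt (fun s : ℝ => z + s • v) s := by fun_prop
    have hDs : ContinuousAt D (z + s • v) := hD _ (by simpa using (hmem s hs).trans_lt hvR)
    exact ((hDs.comp_of_eq hline rfl).clm_apply continuousAt_const).continuousWithinAt
  rw [setAverage_closedBall_add_sub_eq_intervalIntegral μ hE hρ (by linarith) hf hf' hfint]
  have hconst : D z v = ∫ _s in (0 : ℝ)..1, D z v := by simp
  rw [hconst, ← intervalIntegral.integral_sub (hcont.intervalIntegrable_of_Icc zero_le_one)
    intervalIntegrable_const]
  refine (intervalIntegral.norm_integral_le_of_norm_le_const (C := ε * ‖v‖) fun s hs => ?_).trans_eq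
    (by simp)
  have hs' := Ioc_subset_Icc_self (uIoc_of_le (zero_le_one' ℝ) ▸ hs)
  have hclose : ‖D (z + s • v) - D z‖ ≤ ε :=
    mem_closedBall_iff_norm.1 (hDδ _ (by simpa using (hmem s hs').trans_lt hvδ))
  exact (D (z + s • v) - D z).le_of_opNorm_le hclose v

theorem differentiableOn_setAverage_closedBall_and_eqOn (hE : μH[finrank ℝ V - 1] E = 0)
    (hρ : 0 < ρ) (hopen : IsOpen (ball z (4 * ρ) \ E))
    (hf : DifferentiableOn ℂ f (ball z (4 * ρ) \ E))
    (hf' : IntegrableOn (fderiv ℂ f) (ball z (4 * ρ)) μ) :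
    DifferentiableOn ℂ (fun y => ⨍ x in closedBall y ρ, f x ∂μ) (ball z ρ) ∧
      EqOn (fun y => ⨍ x in closedBall y ρ, f x ∂μ) f (ball z ρ \ E) := by
  have hsub {y : V} {r : ℝ} (hy : y ∈ ball z ρ) (hr : r ≤ 3 * ρ) :
      closedBall y r ⊆ ball z (4 * ρ) :=
    closedBall_subset_ball' (by linarith [mem_ball.1 hy])
  have hdiff {y : V} {r : ℝ} (hy : y ∈ ball z ρ) (hr : r ≤ 3 * ρ) :
      ∀ x ∈ closedBall y r \ E, DifferentiableAt ℂ f x := fun x hx =>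
    hf.differentiableAt (hopen.mem_nhds ⟨hsub hy hr hx.1, hx.2⟩)
  have hcont {y : V} (hy : y ∈ ball z ρ \ E) : ∀ᶠ x in 𝓝 y, ContinuousAt f x := by
    have hyU : y ∈ ball z (4 * ρ) \ E := ⟨ball_subset_ball (by linarith) hy.1, hy.2⟩
    filter_upwards [hopen.mem_nhds hyU] with x hx
    exact (hf.differentiableAt (hopen.mem_nhds hx)).continuousAt
  obtain ⟨a, haz, haE⟩ : (ball z ρ \ E).Nonempty := by
    refine nonempty_of_measure_ne_zero (μ := μ) ?_
    rw [measure_sdiff_null (measure_eq_zero_of_hausdorffMeasure_finrank_sub_one μ hE)]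
    exact (measure_ball_pos μ z hρ).ne'
  have hfint : IntegrableOn f (closedBall a (3 * ρ)) μ :=
    integrableOn_closedBall_of_eventually_continuousAt μ hE (hdiff haz le_rfl)
      (hf'.mono_set (hsub haz le_rfl)) (hcont ⟨haz, haE⟩)
  refine ⟨fun y hy => ?_, fun y hy => ?_⟩
  · have hya : closedBall y ρ ⊆ closedBall a (3 * ρ) := closedBall_subset_closedBall' <| by
      linarith [dist_triangle_right y a z, mem_ball.1 hy, mem_ball.1 haz]
    exact (hasFDerivAt_setAverage_closedBall μ hE hρ (R := 2 * ρ) (by linarith)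
      (hdiff hy (by linarith)) (hf'.mono_set (hsub hy (by linarith)))
      (hfint.mono_set hya)).differentiableAt.differentiableWithinAt
  · exact setAverage_closedBall_eq μ hE hρ (hdiff hy.1 (by linarith))
      (hf'.mono_set (hsub hy.1 (by linarith))) (hcont hy)

theorem exists_ball_differentiableOn_eqOn {Ω : Set V} (hΩ : IsOpen Ω) (hU : IsOpen (Ω \ E))
    (hE : μH[finrank ℝ V - 1] E = 0) (hf : DifferentiableOn ℂ f (Ω \ E))
    (hf' : LocallyIntegrableOn (fderiv ℂ f) Ω μ) (hz : z ∈ Ω) :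
    ∃ r > 0, ball z r ⊆ Ω ∧
      ∃ G : V → F, DifferentiableOn ℂ G (ball z r) ∧ EqOn G f (ball z r ∩ (Ω \ E)) := by
  obtain ⟨s, hs, hint⟩ := hf' z hz
  rw [hΩ.nhdsWithin_eq hz] at hs
  obtain ⟨ε, hε, hball⟩ := Metric.mem_nhds_iff.1 (inter_mem hs (hΩ.mem_nhds hz))
  obtain ⟨hballs, hballΩ⟩ := subset_inter_iff.1 hball
  have hε4 : 4 * (ε / 4) = ε := by ring
  have hopen : IsOpen (ball z ε \ E) := by
    rw [← inter_eq_self_of_subset_left hballΩ, inter_sdiff_assoc]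
    exact isOpen_ball.inter hU
  obtain ⟨hdiff, heq⟩ := differentiableOn_setAverage_closedBall_and_eqOn μ hE (ρ := ε / 4)
    (by positivity) (by rwa [hε4]) (hf.mono (by rw [hε4]; exact sdiff_subset_sdiff_left hballΩ))
    (hint.mono_set (by rwa [hε4]))
  have hsub : ball z (ε / 4) ∩ (Ω \ E) ⊆ ball z (ε / 4) \ E := fun y hy => ⟨hy.1, hy.2.2⟩
  exact ⟨ε / 4, by positivity, (ball_subset_ball (by linarith)).trans hballΩ, _, hdiff,
    heq.mono hsub⟩

theorem exists_differentiableOn_eqOn_of_locallyIntegrableOn_fderiv {Ω : Set V} (hΩ : IsOpen Ω)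
    (hE_closed : IsClosed ((↑) ⁻¹' E : Set Ω)) (hE : μH[finrank ℝ V - 1] E = 0)
    (hf : DifferentiableOn ℂ f (Ω \ E)) (hf' : LocallyIntegrableOn (fderiv ℂ f) Ω μ) :
    ∃ G : V → F, DifferentiableOn ℂ G Ω ∧ EqOn G f (Ω \ E) := by
  have hdense : Ω ⊆ closure (Ω \ E) := by
    have hinterior := μ.interior_eq_empty_of_null
      (measure_eq_zero_of_hausdorffMeasure_finrank_sub_one μ hE)
    exact (interior_eq_empty_iff_dense_compl.1 hinterior).open_subset_closure_inter hΩ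
  exact exists_differentiableOn_eqOn_of_forall_exists_ball hdense hf.continuousOn fun z hz =>
    exists_ball_differentiableOn_eqOn μ hΩ (isOpen_sdiff_of_isClosed_preimage_val hΩ hE_closed) hE
      hf hf' hz

end MeanValue

section CoordinateDerivatives

theorem opNorm_le_sum_norm_apply {ι 𝕜 H F : Type*} [Fintype ι] [RCLike 𝕜] [NormedAddCommGroup H]
    [InnerProductSpace 𝕜 H] [SeminormedAddCommGroup F] [NormedSpace 𝕜 F]
    (b : OrthonormalBasis ι 𝕜 H) (L : H →L[𝕜] F) : ‖L‖ ≤ ∑ i, ‖L (b i)‖ := by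
  refine L.opNorm_le_bound (Finset.sum_nonneg fun _ _ => norm_nonneg _) fun y => ?_
  calc ‖L y‖ = ‖∑ i, inner 𝕜 (b i) y • L (b i)‖ := by
        simp only [← map_smul, ← map_sum, b.sum_repr']
    _ ≤ ∑ i, ‖L (b i)‖ * ‖y‖ := by
        refine norm_sum_le_of_le _ fun i _ => ?_
        rw [norm_smul, mul_comm]
        gcongr
        simpa using norm_inner_le_norm (𝕜 := 𝕜) (b i) y
    _ = (∑ i, ‖L (b i)‖) * ‖y‖ := (Finset.sum_mul ..).symm

variable {n : ℕ} {Ω E : Set (EuclideanSpace ℂ (Fin n))} {u f : EuclideanSpace ℂ (Fin n) → ℂ}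

theorem MemLpLocOn.locallyIntegrableOn_of_one_le {p : ℝ} (hp : 1 ≤ p) (hΩ : IsOpen Ω)
    (h : MemLpLocOn p u Ω) : LocallyIntegrableOn u Ω volume := by
  refine (locallyIntegrableOn_iff hΩ.isLocallyClosed).2 fun K hKΩ hK => ?_
  have hpow := h.locallyIntegrableOn.integrableOn_compact_subset hKΩ hK
  refine ((integrableOn_const hK.measure_ne_top (C := (1 : ℝ))).add hpow).mono'
    (h.aestronglyMeasurable.mono_set hKΩ) (.of_forall fun y => ?_)
  rcases le_total ‖u y‖ 1 with hy | hy
  · exact hy.trans (le_add_of_nonneg_right (by positivity))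
  · exact (Real.self_le_rpow_of_one_le hy hp).trans (le_add_of_nonneg_left zero_le_one)

theorem realPartialDeriv_zero_eq_fderiv_single {z : EuclideanSpace ℂ (Fin n)}
    (hf : DifferentiableAt ℂ f z) (k : Fin n) :
    realPartialDeriv (k, 0) f z = fderiv ℂ f z (EuclideanSpace.single k 1) := by
  rw [realPartialDeriv, ((hf.hasFDerivAt.restrictScalars ℝ).hasLineDerivAt _).lineDeriv]
  simp [realCoordVec]

theorem locallyIntegrableOn_fderiv_of_memLpLocOn {p : ℝ} (hp : 1 ≤ p) (hΩ : IsOpen Ω)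
    (hU : IsOpen (Ω \ E)) (hE : volume E = 0) (hf : DifferentiableOn ℂ f (Ω \ E))
    (hfp : ∀ k, MemLpLocOn p (realPartialDeriv (k, 0) f) Ω) :
    LocallyIntegrableOn (fderiv ℂ f) Ω volume := by
  refine (locallyIntegrableOn_iff hΩ.isLocallyClosed).2 fun K hKΩ hK => ?_
  have hsum : IntegrableOn (fun z => ∑ k, ‖realPartialDeriv (k, 0) f z‖) K :=
    integrable_finsetSum _ fun k _ =>
      (((hfp k).locallyIntegrableOn_of_one_le hp hΩ).integrableOn_compact_subset hKΩ hK).norm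
  refine hsum.mono' (measurable_fderiv ℂ f).aestronglyMeasurable ?_
  filter_upwards [ae_restrict_mem hK.measurableSet,
    ae_restrict_of_ae (measure_eq_zero_iff_ae_notMem.1 hE)] with z hzK hzE
  have hz : DifferentiableAt ℂ f z := hf.differentiableAt (hU.mem_nhds ⟨hKΩ hzK, hzE⟩)
  simpa [realPartialDeriv_zero_eq_fderiv_single hz] using
    opNorm_le_sum_norm_apply (EuclideanSpace.basisFun (Fin n) ℂ) (fderiv ℂ f z)

theorem theorem5_general {p : ℝ} (hn : 1 ≤ n) (hp : 1 ≤ p) (hΩ : IsOpen Ω)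
    (hE_closed : IsClosed ((↑) ⁻¹' E : Set Ω)) (hE : μH[2 * (n : ℝ) - 1] E = 0)
    (hf : DifferentiableOn ℂ f (Ω \ E))
    (hfp : ∀ k, MemLpLocOn p (realPartialDeriv (k, 0) f) Ω) :
    ∃ F : EuclideanSpace ℂ (Fin n) → ℂ, DifferentiableOn ℂ F Ω ∧ EqOn F f (Ω \ E) := by
  have : NeZero n := ⟨by lia⟩
  have hE' : μH[finrank ℝ (EuclideanSpace ℂ (Fin n)) - 1] E = 0 := by
    simpa [finrank_real_of_complex] using hE
  exact exists_differentiableOn_eqOn_of_locallyIntegrableOn_fderiv volume hΩ hE_closed hE' hf <|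
    locallyIntegrableOn_fderiv_of_memLpLocOn hp hΩ
      (isOpen_sdiff_of_isClosed_preimage_val hΩ hE_closed)
      (measure_eq_zero_of_hausdorffMeasure_finrank_sub_one volume hE') hf hfp

end CoordinateDerivatives

theorem theorem5 (n : ℕ) (hn : 1 ≤ n) (Ω E : Set (EuclideanSpace ℂ (Fin n)))
    (hΩ_open : IsOpen Ω) (hΩ_conn : IsConnected Ω)
    (hEΩ : E ⊆ Ω) (hE_closed : IsClosed ((↑) ⁻¹' E : Set Ω))
    (hE : Measure.hausdorffMeasure (2 * (n : ℝ) - 1) E = 0)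
    (f : EuclideanSpace ℂ (Fin n) → ℂ) (hf : DifferentiableOn ℂ f (Ω \ E))
    (hL2 : ∀ j : Fin n × Fin 2, MemLpLocOn 2 (realPartialDeriv j f) Ω) :
    ∃ F : EuclideanSpace ℂ (Fin n) → ℂ,
      DifferentiableOn ℂ F Ω ∧ EqOn F f (Ω \ E) :=
  theorem5_general hn one_le_two hΩ_open hE_closed hE hf fun k => hL2 (k, 0)
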